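/- Let $a,b>0$ be real and let $g(t)=\dfrac{1}{a^2+\sinh^2(bt)}$ for $t\in\mathbb R$. Then $g\in L^1(\mathbb R)\cap L^2(\mathbb R)$, and its Fourier transform $$\hat g(k)=\lim_{S,T\to\infty}\int_{-S}^{T}e^{ikt}g(t)\,dt$$ exists for every $k\in\mathbb R$ and is given by $$\hat g(k)=\frac{2\pi\cosh\left(\frac{k\pi}{2b}\right)}{ab\,\sinh\left(\frac{k\pi}{b}\right)}\;\frac{\sinh\left(\frac kb\arccos a\right)}{\sqrt{1-a^2}}.$$ Here the square root and the inverse cosine take their principal values, $\sqrt z=e^{\frac12\operatorname{Log}z}$ for $z\neq0$ and $\arccos z=-i\operatorname{Log}\bigl(z+i\sqrt{1-z^2}\bigr)$, with $\operatorname{Log}$ the principal logarithm, $\operatorname{Im}\operatorname{Log}\in(-\pi,\pi]$ (so for $a>1$ one has $\sqrt{1-a^2}=i\sqrt{a^2-1}$ and $\arccos a=i\log(a+\sqrt{a^2-1})$). The formula holds literally when $a\neq1$ and $k\neq0$; when $a=1$ or $k=0$, where the right-hand side reads $0/0$ or has a vanishing denominator, it is understood as the limit of the right-hand side, with $b$ fixed,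 as $(a',k')\to(a,k)$ through real pairs with $a'\neq1$, $k'\neq0$; this limit exists and equals $\hat g(k)$. -/

import Mathlib

/-- `z` is the value at `k` of the Fourier transform of `f`, with the convention
`∫ e^{ikt} f(t) dt`, the integral being the (two-sided) improper integral
`lim_{S,T → ∞} ∫_{-S}^{T}`, where `S` and `T` tend to infinity independently. -/
def HasFourierTransformAt (f : ℝ → ℝ) (k : ℝ) (z : ℂ) : Prop :=
  Filter.Tendsto
    (fun p : ℝ × ℝ => ∫ t in (-p.1)..p.2, Complex.exp (Complex.I * k * t) * (f t : ℂ))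
    (Filter.atTop ×ˢ Filter.atTop) (nhds z)

/-- Principal inverse cosine, `arccos z = -i Log (z + i √(1 - z²))`, with the
principal logarithm and the principal square root. On `[-1, 1]` it is the usual
real inverse cosine, and `arccos x = i log (x + √(x² - 1))` for real `x > 1`. -/
noncomputable def principalArccos (z : ℂ) : ℂ :=
  -Complex.I * Complex.log (z + Complex.I * Complex.sqrt (1 - z ^ 2))

/-- The function `g(t) = 1 / (a² + sinh²(bt))`. -/
noncomputable def invSqAddSinhSq (a b t : ℝ) : ℝ := 1 / (a ^ 2 + Real.sinh (b * t) ^ 2)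

/-- The closed form
`2π cosh(kπ/(2b)) / (ab sinh(kπ/b)) * (sinh((k/b) arccos a) / √(1 - a²))`,
meaningful for `a, b > 0`, `a ≠ 1`, `k ≠ 0`. -/
noncomputable def closedForm (a b k : ℝ) : ℂ :=
  (2 * Real.pi * Real.cosh (k * Real.pi / (2 * b)) : ℝ) /
      (a * b * Real.sinh (k * Real.pi / b) : ℝ) *
    (Complex.sinh (((k / b : ℝ) : ℂ) * principalArccos (a : ℂ)) /
      Complex.sqrt (1 - (a : ℂ) ^ 2))

open MeasureTheory Filter Topology

/-! ### Bounds on the hyperbolic functions in the strip `|Im z| < π / 2` -/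

/-! Scale to `b = 1`, put `L = k / b`, and let `θ = principalArccos a`, so `cos θ = a` and `|Re θ| <
π/2`. By partial fractions (`tanh_add_sub_tanh_sub`), `tanh (t + iθ) - tanh (t - iθ)` equals `2i a
sin θ · g(t)`. Multiplying by `exp (iLt)` and integrating the derivative over `ℝ` gives zero. This
expresses `ĝ` through integrals of `F(z) = exp (iLz) / cosh² z` along `ℝ ± iθ`, with weights `exp
(±Lθ)`. Both integrals equal `∫ F` over `ℝ`, by shift invariance in the pole-free strip
(`integral_expDivCoshSq_add`), so the weights combine to `2 sinh (Lθ)`. A Beta integral and the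
reflection formula evaluate `∫ F` (`integral_expDivCoshSq`). The exceptional cases `a = 1`, `k = 0`
follow because the Fourier integral is jointly continuous in `(a, k)`. -/

theorem cos_im_mul_cosh_re_le_norm_cosh (z : ℂ) :
    Real.cos z.im * Real.cosh z.re ≤ ‖Complex.cosh z‖ := by
  apply le_of_sq_le_sq _ (norm_nonneg _)
  have h : ‖Complex.cosh z‖ ^ 2 =
      (Real.cosh z.re * Real.cos z.im) ^ 2 + (Real.sinh z.re * Real.sin z.im) ^ 2 := by
    conv_lhs => rw [← Complex.re_add_im z, Complex.cosh_add, Complex.cosh_mul_I, Complex.sinh_mul_I,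
      ← mul_assoc, ← Complex.ofReal_cosh, ← Complex.ofReal_sinh, ← Complex.ofReal_cos,
      ← Complex.ofReal_sin, ← Complex.ofReal_mul, ← Complex.ofReal_mul, Complex.sq_norm,
      Complex.normSq_add_mul_I]
  rw [h]
  nlinarith [sq_nonneg (Real.sinh z.re * Real.sin z.im)]

theorem norm_sinh_le_cosh_re (z : ℂ) : ‖Complex.sinh z‖ ≤ Real.cosh z.re := by
  rw [Complex.sinh, norm_div, Real.cosh_eq, Complex.norm_ofNat]
  gcongr
  refine (norm_sub_le _ _).trans ?_
  simp [Complex.norm_exp]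

theorem Real.cosh_le_exp_mul_cosh_add (x y : ℝ) :
    Real.cosh x ≤ Real.exp |y| * Real.cosh (x + y) := by
  have h1 : Real.exp x ≤ Real.exp |y| * Real.exp (x + y) := by
    rw [← Real.exp_add, Real.exp_le_exp]; linarith [neg_le_abs y]
  have h2 : Real.exp (-x) ≤ Real.exp |y| * Real.exp (-(x + y)) := by
    rw [← Real.exp_add, Real.exp_le_exp]; linarith [le_abs_self y]
  rw [Real.cosh_eq, Real.cosh_eq]
  linarith

theorem Real.abs_le_abs_sinh (x : ℝ) : |x| ≤ |Real.sinh x| := by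
  rw [Real.abs_sinh]
  exact Real.self_le_sinh_iff.2 (abs_nonneg x)

theorem integrable_inv_cosh_sq : Integrable fun t : ℝ => (Real.cosh t ^ 2)⁻¹ := by
  refine integrable_inv_one_add_sq.mono' ?_ (Eventually.of_forall fun t => ?_)
  · exact (Real.continuous_cosh.measurable.pow_const 2).inv.aestronglyMeasurable
  · rw [Real.norm_of_nonneg (by positivity)]
    have h := sq_le_sq.2 (Real.abs_le_abs_sinh t)
    have h2 := Real.cosh_sq t
    gcongr
    linarith

theorem cosh_ne_zero_of_abs_im_lt {z : ℂ} (hz : |z.im| < Real.pi / 2) : Complex.cosh z ≠ 0 := by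
  have h := cos_im_mul_cosh_re_le_norm_cosh z
  have h1 : 0 < Real.cos z.im := Real.cos_pos_of_mem_Ioo (abs_lt.1 hz)
  have h2 := mul_pos h1 (Real.cosh_pos z.re)
  exact norm_pos_iff.1 (h2.trans_le h)

theorem mul_cosh_le_norm_cosh_add {R ρ : ℝ} (hρ : ρ < Real.pi / 2) {s : ℂ} (hR : |s.re| ≤ R)
    (hs : |s.im| ≤ ρ) (t : ℝ) :
    Real.cos ρ / Real.exp R * Real.cosh t ≤ ‖Complex.cosh (t + s)‖ ∧
      Real.cos ρ * ‖Complex.sinh (t + s)‖ ≤ ‖Complex.cosh (t + s)‖ := by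
  have hρ0 : 0 ≤ ρ := (abs_nonneg _).trans hs
  have hc : 0 < Real.cos ρ := Real.cos_pos_of_mem_Ioo ⟨by linarith, hρ⟩
  have h1 : Real.cos ρ ≤ Real.cos s.im := by
    rw [← Real.cos_abs s.im]
    exact Real.cos_le_cos_of_nonneg_of_le_pi (abs_nonneg _) (by linarith [Real.pi_pos]) hs
  have h2 := cos_im_mul_cosh_re_le_norm_cosh (t + s)
  have h3 := norm_sinh_le_cosh_re (t + s)
  simp only [Complex.add_re, Complex.add_im, Complex.ofReal_re, Complex.ofReal_im, zero_add]
    at h2 h3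
  have h4 := Real.cosh_le_exp_mul_cosh_add t s.re
  have h5 := Real.exp_le_exp.2 hR
  have h6 := Real.cosh_pos (t + s.re)
  have h7 : Real.cos ρ * Real.cosh (t + s.re) ≤ ‖Complex.cosh (t + s)‖ :=
    (mul_le_mul_of_nonneg_right h1 h6.le).trans h2
  refine ⟨?_, (mul_le_mul_of_nonneg_left h3 hc.le).trans h7⟩
  refine le_trans ?_ h7
  rw [div_mul_eq_mul_div, div_le_iff₀ (Real.exp_pos R), mul_assoc]
  refine mul_le_mul_of_nonneg_left (h4.trans ?_) hc.le
  rw [mul_comm]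
  gcongr

/-! ### Horizontal shifts of `z ↦ exp (i L z) / cosh² z` -/

/-- The holomorphic function `exp (i L z) / cosh² z` on the strip `|Im z| < π / 2`. -/
noncomputable def expDivCoshSq (L : ℝ) (z : ℂ) : ℂ :=
  Complex.exp (Complex.I * L * z) / Complex.cosh z ^ 2

/-- The complex derivative of `expDivCoshSq L`. -/
noncomputable def expDivCoshSqDeriv (L : ℝ) (z : ℂ) : ℂ :=
  Complex.exp (Complex.I * L * z) *
    (Complex.I * L - 2 * (Complex.sinh z / Complex.cosh z)) / Complex.cosh z ^ 2

theorem hasDerivAt_expDivCoshSq (L : ℝ) {z : ℂ} (hz : Complex.cosh z ≠ 0) :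
    HasDerivAt (expDivCoshSq L) (expDivCoshSqDeriv L z) z := by
  have h1 : HasDerivAt (fun z : ℂ => Complex.exp (Complex.I * L * z))
      (Complex.exp (Complex.I * L * z) * (Complex.I * L)) z := by
    simpa using ((hasDerivAt_id z).const_mul (Complex.I * L)).cexp
  refine (h1.div ((Complex.hasDerivAt_cosh z).pow 2) (pow_ne_zero 2 hz)).congr_deriv ?_
  unfold expDivCoshSqDeriv
  simp only [Pi.pow_apply]
  field_simp
  ring

theorem norm_exp_I_mul_le {L ρ : ℝ} {z : ℂ} (hz : |z.im| ≤ ρ) :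
    ‖Complex.exp (Complex.I * L * z)‖ ≤ Real.exp (|L| * ρ) := by
  rw [Complex.norm_exp, Real.exp_le_exp]
  have : (Complex.I * L * z).re = -(L * z.im) := by simp
  rw [this]
  refine (neg_le_abs _).trans ?_
  rw [abs_mul]
  gcongr

/-- One integrable majorant serves a whole rectangle of shifts, as needed to differentiate under the
integral sign in `s`. -/
theorem exists_bound_expDivCoshSq (L R : ℝ) {ρ : ℝ} (hρ : ρ < Real.pi / 2) :
    ∃ C, ∀ s : ℂ, |s.re| ≤ R → |s.im| ≤ ρ → ∀ t : ℝ,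
      ‖expDivCoshSq L (t + s)‖ ≤ C * (Real.cosh t ^ 2)⁻¹ ∧
      ‖expDivCoshSqDeriv L (t + s)‖ ≤ C * (Real.cosh t ^ 2)⁻¹ := by
  refine ⟨Real.exp (|L| * ρ) * (1 + |L| + 2 / Real.cos ρ) * (Real.exp R / Real.cos ρ) ^ 2,
    fun s hR hs t => ?_⟩
  have hρ0 : 0 ≤ ρ := (abs_nonneg _).trans hs
  have hc : 0 < Real.cos ρ := Real.cos_pos_of_mem_Ioo ⟨by linarith, hρ⟩
  obtain ⟨h1, h2⟩ := mul_cosh_le_norm_cosh_add hρ hR hs t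
  have him : ((t : ℂ) + s).im = s.im := by simp
  have hn : 0 < ‖Complex.cosh (t + s)‖ :=
    norm_pos_iff.2 (cosh_ne_zero_of_abs_im_lt (by rw [him]; linarith))
  have hE : ‖Complex.exp (Complex.I * L * (t + s))‖ ≤ Real.exp (|L| * ρ) :=
    norm_exp_I_mul_le (by rwa [him])
  have hT : ‖Complex.sinh (t + s) / Complex.cosh (t + s)‖ ≤ 1 / Real.cos ρ := by
    rw [norm_div, div_le_div_iff₀ hn hc]; linarith
  have hK : (‖Complex.cosh (t + s)‖ ^ 2)⁻¹ ≤
      (Real.exp R / Real.cos ρ) ^ 2 * (Real.cosh t ^ 2)⁻¹ := by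
    have hpos : 0 < Real.cos ρ / Real.exp R * Real.cosh t := by
      have := Real.cosh_pos t; positivity
    calc (‖Complex.cosh (t + s)‖ ^ 2)⁻¹ ≤ ((Real.cos ρ / Real.exp R * Real.cosh t) ^ 2)⁻¹ := by
          gcongr
      _ = _ := by rw [mul_pow, mul_inv, ← inv_pow, inv_div]
  have hD : ‖Complex.I * L - 2 * (Complex.sinh (t + s) / Complex.cosh (t + s))‖ ≤
      1 + |L| + 2 / Real.cos ρ := by
    refine (norm_sub_le _ _).trans ?_
    rw [norm_mul, norm_mul, Complex.norm_I, Complex.norm_real, Real.norm_eq_abs, Complex.norm_ofNat]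
    have : 2 / Real.cos ρ = 2 * (1 / Real.cos ρ) := by ring
    rw [this]
    linarith
  have hM : 1 ≤ 1 + |L| + 2 / Real.cos ρ := by
    have := abs_nonneg L
    have : 0 < 2 / Real.cos ρ := by positivity
    linarith
  constructor
  · rw [expDivCoshSq, norm_div, norm_pow, div_eq_mul_inv, mul_assoc (Real.exp _ * _)]
    refine mul_le_mul (hE.trans ?_) hK (by positivity) (by positivity)
    exact le_mul_of_one_le_right (Real.exp_pos _).le hM
  · rw [expDivCoshSqDeriv, norm_div, norm_mul, norm_pow, div_eq_mul_inv,
      mul_assoc (_ * _) (_ ^ 2) (_⁻¹)]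
    exact mul_le_mul (mul_le_mul hE hD (norm_nonneg _) (Real.exp_pos _).le) hK
      (by positivity) (by positivity)

theorem aestronglyMeasurable_expDivCoshSq (L : ℝ) (s : ℂ) :
    AEStronglyMeasurable (fun t : ℝ => expDivCoshSq L (t + s)) ∧
    AEStronglyMeasurable (fun t : ℝ => expDivCoshSqDeriv L (t + s)) := by
  constructor <;> refine Measurable.aestronglyMeasurable ?_ <;>
    simp only [expDivCoshSq, expDivCoshSqDeriv] <;> fun_prop

theorem integrable_expDivCoshSq (L : ℝ) {s : ℂ} (hs : |s.im| < Real.pi / 2) :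
    Integrable (fun t : ℝ => expDivCoshSq L (t + s)) ∧
    Integrable (fun t : ℝ => expDivCoshSqDeriv L (t + s)) := by
  obtain ⟨C, hC⟩ := exists_bound_expDivCoshSq L |s.re| hs
  have hb := integrable_inv_cosh_sq.const_mul C
  obtain ⟨m1, m2⟩ := aestronglyMeasurable_expDivCoshSq L s
  exact ⟨hb.mono' m1 (Eventually.of_forall fun t => (hC s le_rfl le_rfl t).1),
    hb.mono' m2 (Eventually.of_forall fun t => (hC s le_rfl le_rfl t).2)⟩

/-- Differentiating the integrand in `s` is the same as differentiating it in `t`, so the derivative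
is the integral of a total derivative and vanishes. This replaces a contour shift. -/
theorem hasDerivAt_integral_expDivCoshSq (L : ℝ) {s : ℂ} (hs : |s.im| < Real.pi / 2) :
    HasDerivAt (fun s : ℂ => ∫ t : ℝ, expDivCoshSq L (t + s)) 0 s := by
  obtain ⟨ρ, hsρ, hρ⟩ := exists_between hs
  obtain ⟨C, hC⟩ := exists_bound_expDivCoshSq L (|s.re| + 1) hρ
  have hU : {w : ℂ | |w.re| < |s.re| + 1 ∧ |w.im| < ρ} ∈ 𝓝 s := by
    refine IsOpen.mem_nhds (IsOpen.inter ?_ ?_) ⟨by simp, hsρ⟩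
    · exact isOpen_lt Complex.continuous_re.abs continuous_const
    · exact isOpen_lt Complex.continuous_im.abs continuous_const
  have him (t : ℝ) (w : ℂ) : ((t : ℂ) + w).im = w.im := by simp
  have hderiv (t : ℝ) (w : ℂ) (hw : |w.im| < Real.pi / 2) :
      HasDerivAt (expDivCoshSq L) (expDivCoshSqDeriv L (t + w)) (t + w) :=
    hasDerivAt_expDivCoshSq L (cosh_ne_zero_of_abs_im_lt (by rwa [him]))
  have h := (hasDerivAt_integral_of_dominated_loc_of_deriv_le
    (F := fun (w : ℂ) (t : ℝ) => expDivCoshSq L (t + w))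
    (F' := fun (w : ℂ) (t : ℝ) => expDivCoshSqDeriv L (t + w)) hU
    (Eventually.of_forall fun w => (aestronglyMeasurable_expDivCoshSq L w).1)
    (integrable_expDivCoshSq L hs).1 (aestronglyMeasurable_expDivCoshSq L s).2
    (Eventually.of_forall fun t w hw => (hC w hw.1.le hw.2.le t).2)
    (integrable_inv_cosh_sq.const_mul C)
    (Eventually.of_forall fun t w hw => (hderiv t w (hw.2.trans hρ)).comp_const_add (t : ℂ) w)).2
  refine h.congr_deriv ?_
  refine integral_eq_zero_of_hasDerivAt_of_integrable
    (f := fun t : ℝ => expDivCoshSq L (t + s)) (fun t => ?_)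
    (integrable_expDivCoshSq L hs).2 (integrable_expDivCoshSq L hs).1
  exact ((hderiv t s hs).comp_add_const (t : ℂ) s).comp_ofReal

theorem integral_expDivCoshSq_add (L : ℝ) {s : ℂ} (hs : |s.im| < Real.pi / 2) :
    ∫ t : ℝ, expDivCoshSq L (t + s) = ∫ t : ℝ, expDivCoshSq L t := by
  have hS : {w : ℂ | |w.im| < Real.pi / 2} =
      Complex.imLm ⁻¹' Set.Ioo (-(Real.pi / 2)) (Real.pi / 2) := by
    ext w; simp [abs_lt]
  have hopen : IsOpen {w : ℂ | |w.im| < Real.pi / 2} :=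
    isOpen_lt Complex.continuous_im.abs continuous_const
  have hconn : IsPreconnected {w : ℂ | |w.im| < Real.pi / 2} := by
    rw [hS]
    exact ((convex_Ioo _ _).linear_preimage Complex.imLm).isPreconnected
  have h := hopen.is_const_of_deriv_eq_zero hconn
    (f := fun s : ℂ => ∫ t : ℝ, expDivCoshSq L (t + s))
    (fun w hw => (hasDerivAt_integral_expDivCoshSq L hw).differentiableAt.differentiableWithinAt)
    (fun w hw => (hasDerivAt_integral_expDivCoshSq L hw).deriv) (x := s) (y := 0) hs
    (by simp [Real.pi_pos])
  simpa using h

/-! ### The Fourier transform of `1 / cosh²` -/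

theorem ofReal_sigmoid_cpow_mul_one_sub_cpow (κ u : ℝ) :
    (Real.sigmoid u : ℂ) ^ (Complex.I * κ) * (1 - Real.sigmoid u : ℂ) ^ (-(Complex.I * κ)) =
      Complex.exp (Complex.I * κ * u) := by
  have h1 := Real.sigmoid_pos u
  have h2 : 0 < 1 - Real.sigmoid u := by linarith [Real.sigmoid_lt_one u]
  have h3 : Real.log (Real.sigmoid u) - Real.log (1 - Real.sigmoid u) = u := by
    have : Real.sigmoid u = Real.exp u * (1 - Real.sigmoid u) := by
      rw [Real.sigmoid_def, Real.exp_neg]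
      have := Real.exp_pos u
      field_simp
      ring
    rw [this, Real.log_mul (Real.exp_pos u).ne' h2.ne', Real.log_exp, ← this]
    ring
  have hc : (1 - Real.sigmoid u : ℂ) = ((1 - Real.sigmoid u : ℝ) : ℂ) := by push_cast; rfl
  rw [hc, Complex.cpow_def_of_ne_zero (by exact_mod_cast h1.ne'),
    Complex.cpow_def_of_ne_zero (by exact_mod_cast h2.ne'), ← Complex.exp_add,
    ← Complex.ofReal_log h1.le, ← Complex.ofReal_log h2.le]
  congr 1
  nth_rewrite 3 [← h3]
  push_cast
  ring

theorem sigmoid_mul_one_sub_sigmoid (t : ℝ) :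
    Real.sigmoid (2 * t) * (1 - Real.sigmoid (2 * t)) = (4 * Real.cosh t ^ 2)⁻¹ := by
  have h : Real.exp (-(2 * t)) = (Real.exp t)⁻¹ ^ 2 := by
    rw [← Real.exp_neg, ← Real.exp_nat_mul]; congr 1; push_cast; ring
  rw [Real.sigmoid_def, h, Real.cosh_eq, Real.exp_neg]
  have := Real.exp_pos t
  field_simp
  ring

/-- Substitute `x = σ(u)`: then `dx = σ(1 - σ) du` and `log (x / (1 - x)) = u`. -/
theorem betaIntegral_eq_integral_sigmoid (κ : ℝ) :
    Complex.betaIntegral (1 + Complex.I * κ) (1 - Complex.I * κ) =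
      ∫ u : ℝ, ((Real.sigmoid u * (1 - Real.sigmoid u) : ℝ) : ℂ) *
        Complex.exp (Complex.I * κ * u) := by
  have h := integral_image_eq_integral_abs_deriv_smul MeasurableSet.univ
    (fun u _ => (Real.hasDerivAt_sigmoid u).hasDerivWithinAt) Real.sigmoid_injective.injOn
    (fun x : ℝ => (x : ℂ) ^ (Complex.I * κ) * (1 - x : ℂ) ^ (-(Complex.I * κ)))
  rw [Set.image_univ, Real.range_sigmoid, setIntegral_univ] at h
  rw [Complex.betaIntegral, intervalIntegral.integral_of_le zero_le_one, integral_Ioc_eq_integral_Ioo,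
    show (1 + Complex.I * κ - 1 : ℂ) = Complex.I * κ by ring,
    show (1 - Complex.I * κ - 1 : ℂ) = -(Complex.I * κ) by ring, h]
  refine integral_congr_ae (Eventually.of_forall fun u => ?_)
  have h1 := Real.sigmoid_pos u
  have h2 : 0 < 1 - Real.sigmoid u := by linarith [Real.sigmoid_lt_one u]
  simp only [ofReal_sigmoid_cpow_mul_one_sub_cpow]
  rw [abs_of_pos (mul_pos h1 h2), Complex.real_smul]

theorem betaIntegral_one_add_one_sub {z : ℂ} (hz : z ≠ 0) (h1 : -1 < z.re) (h2 : z.re < 1) :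
    Complex.betaIntegral (1 + z) (1 - z) = Real.pi * z / Complex.sin (Real.pi * z) := by
  have h := Complex.Gamma_mul_Gamma_eq_betaIntegral (s := 1 + z) (t := 1 - z)
    (by simp; linarith) (by simp; linarith)
  rw [show (1 + z + (1 - z) : ℂ) = 1 + 1 by ring, Complex.Gamma_add_one 1 one_ne_zero,
    Complex.Gamma_one, one_mul, one_mul, add_comm 1 z, Complex.Gamma_add_one z hz, mul_assoc,
    Complex.Gamma_mul_Gamma_one_sub] at h
  rw [add_comm 1 z, ← h]
  ring

theorem integral_expDivCoshSq {L : ℝ} (hL : L ≠ 0) :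
    ∫ t : ℝ, expDivCoshSq L t = ((Real.pi * L / Real.sinh (Real.pi * L / 2) : ℝ) : ℂ) := by
  have h := betaIntegral_eq_integral_sigmoid (L / 2)
  rw [betaIntegral_one_add_one_sub (by simp [hL]) (by simp) (by simp)] at h
  -- The substitution `u = 2t` turns `σ(1 - σ)` into `1 / (4 cosh² t)`, hence the frequency `L / 2`
  -- above.
  have h2 := Measure.integral_comp_mul_left (fun u : ℝ =>
    ((Real.sigmoid u * (1 - Real.sigmoid u) : ℝ) : ℂ) * Complex.exp (Complex.I * (L / 2 : ℝ) * u)) 2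
  rw [← h] at h2
  have h3 : ∀ t : ℝ, expDivCoshSq L t =
      4 * (((Real.sigmoid (2 * t) * (1 - Real.sigmoid (2 * t)) : ℝ) : ℂ) *
        Complex.exp (Complex.I * (L / 2 : ℝ) * (2 * t : ℝ))) := by
    intro t
    rw [sigmoid_mul_one_sub_sigmoid, expDivCoshSq]
    push_cast
    rw [show Complex.I * (L / 2) * (2 * t) = Complex.I * L * t by ring, mul_inv]
    ring
  simp only [h3]
  rw [integral_const_mul, h2, show (Real.pi * (Complex.I * (L / 2 : ℝ)) : ℂ) =
    ((Real.pi * L / 2 : ℝ) : ℂ) * Complex.I by push_cast; ring, Complex.sin_mul_I,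
    ← Complex.ofReal_sinh, Complex.real_smul]
  have hs : Real.sinh (Real.pi * L / 2) ≠ 0 := by
    rw [Ne, Real.sinh_eq_zero]; have := Real.pi_pos; positivity
  have hs' : ((Real.sinh (Real.pi * L / 2) : ℝ) : ℂ) ≠ 0 := by exact_mod_cast hs
  rw [abs_of_pos (by norm_num), Complex.ofReal_div, Complex.ofReal_div]
  field_simp
  push_cast
  ring

/-! ### The principal inverse cosine of a positive real number -/

theorem sq_complexSqrt (z : ℂ) : Complex.sqrt z ^ 2 = z := by
  rcases eq_or_ne z 0 with rfl | hz
  · simp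
  · rw [sqrt_eq_exp hz, ← Complex.exp_nat_mul]
    push_cast
    rw [mul_div_cancel₀ _ (two_ne_zero), Complex.exp_log hz]

/-- Since `r²` is real, `r` is real or purely imaginary. In the first case the real part is `a`; in
the second `(Im r)² = a² - 1 < a²`. -/
theorem re_add_I_mul_pos_of_sq {a : ℝ} (ha : 0 < a) {r : ℂ} (hr : r ^ 2 = 1 - (a : ℂ) ^ 2) :
    0 < ((a : ℂ) + Complex.I * r).re := by
  have h1 := congrArg Complex.re hr
  have h2 := congrArg Complex.im hr
  simp only [sq, Complex.mul_re, Complex.mul_im, Complex.sub_re, Complex.sub_im, Complex.one_re,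
    Complex.one_im, Complex.ofReal_re, Complex.ofReal_im] at h1 h2
  simp only [Complex.add_re, Complex.mul_re, Complex.I_re, Complex.I_im, Complex.ofReal_re]
  have h3 : r.re * r.im = 0 := by linarith
  rcases mul_eq_zero.1 h3 with h | h
  · rw [h] at h1 ⊢
    nlinarith
  · rw [h]
    linarith

theorem principalArccos_spec {a : ℝ} (ha : 0 < a) :
    Complex.cos (principalArccos a) = a ∧
    Complex.sin (principalArccos a) = Complex.sqrt (1 - (a : ℂ) ^ 2) ∧
    |(principalArccos a).re| < Real.pi / 2 := by
  set r := Complex.sqrt (1 - (a : ℂ) ^ 2) with hr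
  have hr2 : r ^ 2 = 1 - (a : ℂ) ^ 2 := sq_complexSqrt _
  have hre := re_add_I_mul_pos_of_sq ha hr2
  have hθ : principalArccos a = -Complex.I * Complex.log (a + Complex.I * r) := rfl
  have hinv : ((a : ℂ) + Complex.I * r) * (a - Complex.I * r) = 1 := by
    linear_combination hr2 - r ^ 2 * Complex.I_sq
  have hw : (a : ℂ) + Complex.I * r ≠ 0 := left_ne_zero_of_mul_eq_one hinv
  have he : Complex.exp (principalArccos a * Complex.I) = a + Complex.I * r := by
    rw [hθ, show -Complex.I * Complex.log (a + Complex.I * r) * Complex.I =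
      Complex.log (a + Complex.I * r) by
        linear_combination -Complex.log (a + Complex.I * r) * Complex.I_sq,
      Complex.exp_log hw]
  have he' : Complex.exp (-principalArccos a * Complex.I) = a - Complex.I * r := by
    rw [neg_mul, Complex.exp_neg, he]
    exact inv_eq_of_mul_eq_one_right hinv
  refine ⟨?_, ?_, ?_⟩
  · rw [Complex.cos, he, he']; ring
  · rw [Complex.sin, he, he']; linear_combination -r * Complex.I_sq
  · have : (principalArccos a).re = (a + Complex.I * r : ℂ).arg := by
      rw [hθ]; simp [Complex.log_im]
    rw [this]
    exact Complex.abs_arg_lt_pi_div_two_iff.2 (Or.inl hre)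

/-! ### Integrability of `invSqAddSinhSq` -/

theorem add_sinh_sq_pos {a : ℝ} (ha : 0 < a) (x : ℝ) : 0 < a ^ 2 + Real.sinh x ^ 2 := by
  positivity

theorem continuous_invSqAddSinhSq {a : ℝ} (ha : 0 < a) (b : ℝ) :
    Continuous (invSqAddSinhSq a b) := by
  unfold invSqAddSinhSq
  have : ∀ t, a ^ 2 + Real.sinh (b * t) ^ 2 ≠ 0 := fun t => (add_sinh_sq_pos ha _).ne'
  fun_prop (disch := assumption)

theorem invSqAddSinhSq_pos {a : ℝ} (ha : 0 < a) (b t : ℝ) : 0 < invSqAddSinhSq a b t :=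
  one_div_pos.2 (add_sinh_sq_pos ha _)

theorem invSqAddSinhSq_anti {a c : ℝ} (hc : 0 < c) (hca : c ≤ a) (b t : ℝ) :
    invSqAddSinhSq a b t ≤ invSqAddSinhSq c b t := by
  have := add_sinh_sq_pos hc (b * t)
  unfold invSqAddSinhSq
  gcongr

theorem integrable_invSqAddSinhSq {a b : ℝ} (ha : 0 < a) (hb : b ≠ 0) :
    Integrable (invSqAddSinhSq a b) := by
  have h1 : Integrable (fun t : ℝ => 1 / (a ^ 2 + Real.sinh t ^ 2)) := by
    -- The constant is chosen so that `(1 + 1/a²)(a² + sinh² t) ≥ 1 + sinh² t = cosh² t`.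
    refine (integrable_inv_cosh_sq.const_mul (1 + 1 / a ^ 2)).mono' ?_
      (Eventually.of_forall fun t => ?_)
    · have : ∀ t, a ^ 2 + Real.sinh t ^ 2 ≠ 0 := fun t => (add_sinh_sq_pos ha _).ne'
      refine Continuous.aestronglyMeasurable ?_
      fun_prop (disch := assumption)
    · have h := add_sinh_sq_pos ha t
      have hc := Real.cosh_pos t
      rw [Real.norm_of_nonneg (by positivity), ← div_eq_mul_inv,
        div_le_div_iff₀ h (by positivity), Real.cosh_sq]
      have : (1 + 1 / a ^ 2) * (a ^ 2 + Real.sinh t ^ 2) =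
        a ^ 2 + Real.sinh t ^ 2 + 1 + Real.sinh t ^ 2 / a ^ 2 := by field_simp; ring
      rw [this]
      have h3 : 0 ≤ Real.sinh t ^ 2 / a ^ 2 := by positivity
      nlinarith [sq_nonneg a]
  exact h1.comp_mul_left' hb

theorem memLp_two_invSqAddSinhSq {a b : ℝ} (ha : 0 < a) (hb : b ≠ 0) :
    MemLp (invSqAddSinhSq a b) 2 := by
  have hm := (continuous_invSqAddSinhSq ha b).aestronglyMeasurable (μ := volume)
  rw [memLp_two_iff_integrable_sq hm]
  simp only [sq]
  refine (integrable_invSqAddSinhSq ha hb).bdd_mul hm (c := 1 / a ^ 2)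
    (Eventually.of_forall fun t => ?_)
  rw [Real.norm_of_nonneg (invSqAddSinhSq_pos ha b t).le, invSqAddSinhSq]
  gcongr
  nlinarith [sq_nonneg (Real.sinh (b * t))]

theorem norm_exp_I_mul_mul_ofReal (k t : ℝ) : ‖Complex.exp (Complex.I * k * t)‖ = 1 := by
  rw [mul_assoc, ← Complex.ofReal_mul, mul_comm, Complex.norm_exp_ofReal_mul_I]

theorem continuous_fourier_invSqAddSinhSq {a : ℝ} (ha : 0 < a) (b k : ℝ) :
    Continuous fun t : ℝ => Complex.exp (Complex.I * k * t) * (invSqAddSinhSq a b t : ℂ) :=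
  (by fun_prop : Continuous fun t : ℝ => Complex.exp (Complex.I * k * t)).mul
    (Complex.continuous_ofReal.comp (continuous_invSqAddSinhSq ha b))

theorem norm_fourier_invSqAddSinhSq {a : ℝ} (ha : 0 < a) (b k t : ℝ) :
    ‖Complex.exp (Complex.I * k * t) * (invSqAddSinhSq a b t : ℂ)‖ = invSqAddSinhSq a b t := by
  rw [norm_mul, norm_exp_I_mul_mul_ofReal, one_mul, Complex.norm_real,
    Real.norm_of_nonneg (invSqAddSinhSq_pos ha b t).le]

theorem integrable_fourier_invSqAddSinhSq {a b : ℝ} (ha : 0 < a) (hb : b ≠ 0) (k : ℝ) :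
    Integrable fun t : ℝ => Complex.exp (Complex.I * k * t) * (invSqAddSinhSq a b t : ℂ) :=
  (integrable_invSqAddSinhSq ha hb).mono'
    (continuous_fourier_invSqAddSinhSq ha b k).aestronglyMeasurable
    (Eventually.of_forall fun t => (norm_fourier_invSqAddSinhSq ha b k t).le)

theorem hasFourierTransformAt_invSqAddSinhSq {a b : ℝ} (ha : 0 < a) (hb : b ≠ 0) (k : ℝ) :
    HasFourierTransformAt (invSqAddSinhSq a b) k
      (∫ t : ℝ, Complex.exp (Complex.I * k * t) * (invSqAddSinhSq a b t : ℂ)) :=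
  intervalIntegral_tendsto_integral (integrable_fourier_invSqAddSinhSq ha hb k)
    (tendsto_neg_atTop_atBot.comp tendsto_fst) tendsto_snd

theorem continuousAt_integral_fourier_invSqAddSinhSq {a b : ℝ} (ha : 0 < a) (hb : b ≠ 0) (k : ℝ) :
    ContinuousAt (fun p : ℝ × ℝ =>
      ∫ t : ℝ, Complex.exp (Complex.I * p.2 * t) * (invSqAddSinhSq p.1 b t : ℂ)) (a, k) := by
  have hev : ∀ᶠ p : ℝ × ℝ in 𝓝 (a, k), a / 2 < p.1 :=
    continuousAt_fst.eventually (lt_mem_nhds (half_lt_self ha))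
  -- The modulus of the integrand does not depend on `k` and decreases in `a`, so its value at `a /
  -- 2` dominates nearby.
  refine continuousAt_of_dominated (bound := invSqAddSinhSq (a / 2) b)
    (hev.mono fun p hp => ?_) (hev.mono fun p hp => Eventually.of_forall fun t => ?_)
    (integrable_invSqAddSinhSq (half_pos ha) hb) (Eventually.of_forall fun t => ?_)
  · exact (continuous_fourier_invSqAddSinhSq ((half_pos ha).trans hp) b p.2).aestronglyMeasurable
  · rw [norm_fourier_invSqAddSinhSq ((half_pos ha).trans hp)]
    exact invSqAddSinhSq_anti (half_pos ha) hp.le b t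
  · refine ContinuousAt.mul (by fun_prop) (Complex.continuous_ofReal.continuousAt.comp ?_)
    unfold invSqAddSinhSq
    exact ContinuousAt.div (by fun_prop) (by fun_prop) (add_sinh_sq_pos ha _).ne'

/-! ### Evaluation of the Fourier integral -/

theorem hasDerivAt_complexTanh {z : ℂ} (hz : Complex.cosh z ≠ 0) :
    HasDerivAt Complex.tanh (1 / Complex.cosh z ^ 2) z := by
  have h : HasDerivAt (fun z => Complex.sinh z / Complex.cosh z) (1 / Complex.cosh z ^ 2) z := by
    refine ((Complex.hasDerivAt_sinh z).div (Complex.hasDerivAt_cosh z) hz).congr_deriv ?_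
    rw [← Complex.cosh_sq_sub_sinh_sq z]
    ring
  exact h

theorem tanh_add_sub_tanh_sub (θ : ℂ) {t : ℂ} (h1 : Complex.cosh (t + Complex.I * θ) ≠ 0)
    (h2 : Complex.cosh (t - Complex.I * θ) ≠ 0) :
    Complex.tanh (t + Complex.I * θ) - Complex.tanh (t - Complex.I * θ) =
      2 * Complex.I * Complex.sin θ * Complex.cos θ *
        (1 / (Complex.cos θ ^ 2 + Complex.sinh t ^ 2)) := by
  have hden : Complex.cos θ ^ 2 + Complex.sinh t ^ 2 =
      Complex.cosh (t + Complex.I * θ) * Complex.cosh (t - Complex.I * θ) := by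
    rw [Complex.cosh_add, Complex.cosh_sub, mul_comm Complex.I, Complex.cosh_mul_I,
      Complex.sinh_mul_I]
    linear_combination (-Complex.cos θ ^ 2) * Complex.cosh_sq_sub_sinh_sq t -
      Complex.sinh t ^ 2 * Complex.sin_sq_add_cos_sq θ +
      Complex.sinh t ^ 2 * Complex.sin θ ^ 2 * Complex.I_sq
  have hnum : Complex.sinh (t + Complex.I * θ) * Complex.cosh (t - Complex.I * θ) -
      Complex.cosh (t + Complex.I * θ) * Complex.sinh (t - Complex.I * θ) =
      2 * Complex.I * Complex.sin θ * Complex.cos θ := by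
    rw [← Complex.sinh_sub, show t + Complex.I * θ - (t - Complex.I * θ) =
      2 * (θ * Complex.I) by ring,
      Complex.sinh_two_mul, Complex.cosh_mul_I, Complex.sinh_mul_I]
    ring
  rw [hden, Complex.tanh_eq_sinh_div_cosh, Complex.tanh_eq_sinh_div_cosh, div_sub_div _ _ h1 h2,
    hnum, mul_one_div]

theorem integral_fourier_invSqAddSinhSq_one {a : ℝ} (ha : 0 < a) {L : ℝ} (hL : L ≠ 0) {θ : ℂ}
    (hcos : Complex.cos θ = a) (hsin : Complex.sin θ ≠ 0) (hθ : |θ.re| < Real.pi / 2) :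
    ∫ t : ℝ, Complex.exp (Complex.I * L * t) * (invSqAddSinhSq a 1 t : ℂ) =
      ((Real.pi / (a * Real.sinh (Real.pi * L / 2)) : ℝ) : ℂ) *
        (Complex.sinh (L * θ) / Complex.sin θ) := by
  set I : ℂ := ∫ t : ℝ, Complex.exp (Complex.I * L * t) * (invSqAddSinhSq a 1 t : ℂ) with hI
  -- Only `Re θ` matters for staying in the strip, so real and imaginary `θ` (`a < 1` and `a > 1`)
  -- are treated alike.
  have him1 : |(Complex.I * θ).im| < Real.pi / 2 := by simpa using hθ
  have him2 : |(-(Complex.I * θ)).im| < Real.pi / 2 := by simpa using hθ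
  have hne1 (t : ℝ) : Complex.cosh (t + Complex.I * θ) ≠ 0 :=
    cosh_ne_zero_of_abs_im_lt (by simpa using hθ)
  have hne2 (t : ℝ) : Complex.cosh (t - Complex.I * θ) ≠ 0 :=
    cosh_ne_zero_of_abs_im_lt (by simpa using hθ)
  have hint := integrable_fourier_invSqAddSinhSq ha one_ne_zero L
  have hf (t : ℝ) : Complex.exp (Complex.I * L * t) *
      (Complex.tanh (t + Complex.I * θ) - Complex.tanh (t - Complex.I * θ)) =
      2 * Complex.I * Complex.sin θ * a *
        (Complex.exp (Complex.I * L * t) * (invSqAddSinhSq a 1 t : ℂ)) := by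
    rw [tanh_add_sub_tanh_sub θ (hne1 t) (hne2 t), hcos, invSqAddSinhSq]
    push_cast
    rw [one_mul]
    ring
  have hint1 := integrable_expDivCoshSq L him1
  have hint2 := integrable_expDivCoshSq L him2
  have hderiv (t : ℝ) : HasDerivAt (fun t : ℝ => Complex.exp (Complex.I * L * t) *
      (Complex.tanh (t + Complex.I * θ) - Complex.tanh (t - Complex.I * θ)))
      (Complex.I * L * (2 * Complex.I * Complex.sin θ * a *
        (Complex.exp (Complex.I * L * t) * (invSqAddSinhSq a 1 t : ℂ))) +
        (Complex.exp (L * θ) * expDivCoshSq L (t + Complex.I * θ) -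
        Complex.exp (-(L * θ)) * expDivCoshSq L (t + -(Complex.I * θ)))) t := by
    have h1 : HasDerivAt (fun z : ℂ => Complex.exp (Complex.I * L * z))
        (Complex.exp (Complex.I * L * t) * (Complex.I * L)) (t : ℂ) := by
      simpa using ((hasDerivAt_id (t : ℂ)).const_mul (Complex.I * L)).cexp
    have h2 := (hasDerivAt_complexTanh (hne1 t)).comp_add_const (t : ℂ) (Complex.I * θ)
    have h3 := (hasDerivAt_complexTanh (hne2 t)).comp_sub_const (t : ℂ) (Complex.I * θ)
    refine (h1.mul (h2.sub h3)).comp_ofReal.congr_deriv ?_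
    rw [← hf, expDivCoshSq, expDivCoshSq, mul_div_assoc', mul_div_assoc', ← Complex.exp_add,
      ← Complex.exp_add,
      show L * θ + Complex.I * L * (t + Complex.I * θ) = Complex.I * L * t by
        linear_combination L * θ * Complex.I_sq,
      show -(L * θ) + Complex.I * L * (t + -(Complex.I * θ)) = Complex.I * L * t by
        linear_combination -L * θ * Complex.I_sq, ← sub_eq_add_neg]
    simp only [Pi.sub_apply]
    ring
  have hzero := integral_eq_zero_of_hasDerivAt_of_integrable hderiv
    (((hint.const_mul _).const_mul _).add ((hint1.1.const_mul _).sub (hint2.1.const_mul _)))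
    (by simpa only [hf] using hint.const_mul (2 * Complex.I * Complex.sin θ * a))
  have hsub : Integrable fun t : ℝ => Complex.exp (L * θ) * expDivCoshSq L (t + Complex.I * θ) -
      Complex.exp (-(L * θ)) * expDivCoshSq L (t + -(Complex.I * θ)) :=
    (hint1.1.const_mul _).sub (hint2.1.const_mul _)
  rw [integral_add ((hint.const_mul _).const_mul _) hsub,
    integral_sub (hint1.1.const_mul _) (hint2.1.const_mul _), integral_const_mul,
    integral_const_mul, integral_const_mul, integral_const_mul, ← hI,
    integral_expDivCoshSq_add L him1, integral_expDivCoshSq_add L him2,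
    integral_expDivCoshSq hL] at hzero
  have hs : Real.sinh (Real.pi * L / 2) ≠ 0 := by
    rw [Ne, Real.sinh_eq_zero]; have := Real.pi_pos; positivity
  have hs' : ((Real.sinh (Real.pi * L / 2) : ℝ) : ℂ) ≠ 0 := by exact_mod_cast hs
  have hL' : (L : ℂ) ≠ 0 := by exact_mod_cast hL
  have ha' : (a : ℂ) ≠ 0 := by exact_mod_cast ha.ne'
  have hkey : 2 * L * Complex.sin θ * a * I = 2 * Complex.sinh (L * θ) *
      ((Real.pi * L / Real.sinh (Real.pi * L / 2) : ℝ) : ℂ) := by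
    rw [Complex.two_sinh]
    linear_combination -hzero + 2 * L * Complex.sin θ * a * I * Complex.I_sq
  simp only [Complex.ofReal_div, Complex.ofReal_mul] at hkey ⊢
  field_simp at hkey ⊢
  linear_combination hkey

theorem integral_fourier_invSqAddSinhSq {a b k : ℝ} (ha : 0 < a) (hb : 0 < b) (ha1 : a ≠ 1)
    (hk : k ≠ 0) :
    ∫ t : ℝ, Complex.exp (Complex.I * k * t) * (invSqAddSinhSq a b t : ℂ) = closedForm a b k := by
  obtain ⟨hcos, hsin, hre⟩ := principalArccos_spec ha
  have hr : Complex.sqrt (1 - (a : ℂ) ^ 2) ≠ 0 := by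
    intro h0
    have h := sq_complexSqrt (1 - (a : ℂ) ^ 2)
    rw [h0] at h
    have h2 : (1 - a ^ 2 : ℝ) = 0 := by
      exact_mod_cast (by linear_combination -h : (1 - (a : ℂ) ^ 2) = 0)
    exact ha1 (by nlinarith)
  have hL : k / b ≠ 0 := div_ne_zero hk hb.ne'
  have h1 := integral_fourier_invSqAddSinhSq_one ha hL hcos (hsin ▸ hr) hre
  have h2 := Measure.integral_comp_mul_left (fun t : ℝ =>
    Complex.exp (Complex.I * (k / b : ℝ) * t) * (invSqAddSinhSq a 1 t : ℂ)) b
  have h3 (t : ℝ) : Complex.exp (Complex.I * (k / b : ℝ) * (b * t : ℝ)) *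
      (invSqAddSinhSq a 1 (b * t) : ℂ) =
      Complex.exp (Complex.I * k * t) * (invSqAddSinhSq a b t : ℂ) := by
    have hb' : (b : ℂ) ≠ 0 := by exact_mod_cast hb.ne'
    rw [invSqAddSinhSq, invSqAddSinhSq, one_mul]
    congr 2
    push_cast
    field_simp
  simp only [h3] at h2
  rw [h2, h1, hsin, closedForm, abs_of_pos (inv_pos.2 hb), Complex.real_smul, ← mul_assoc]
  congr 1
  rw [← Complex.ofReal_mul, ← Complex.ofReal_div]
  congr 1
  have hs : Real.sinh (Real.pi * (k / b) / 2) ≠ 0 := by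
    rw [Ne, Real.sinh_eq_zero]; have := Real.pi_pos; positivity
  have hc := Real.cosh_pos (Real.pi * (k / b) / 2)
  -- The `cosh` factor of the closed form only undoes the duplication `sinh 2x = 2 sinh x cosh x`.
  rw [show k * Real.pi / (2 * b) = Real.pi * (k / b) / 2 by field_simp,
    show k * Real.pi / b = 2 * (Real.pi * (k / b) / 2) by field_simp, Real.sinh_two_mul]
  field_simp

theorem mainTheorem2 (a b : ℝ) (ha : 0 < a) (hb : 0 < b) :
    MeasureTheory.Integrable (invSqAddSinhSq a b) MeasureTheory.volume ∧
    MeasureTheory.MemLp (invSqAddSinhSq a b) 2 MeasureTheory.volume ∧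
    (∀ k : ℝ, a ≠ 1 → k ≠ 0 →
      HasFourierTransformAt (invSqAddSinhSq a b) k (closedForm a b k)) ∧
    (∀ k : ℝ, ∃ z : ℂ, HasFourierTransformAt (invSqAddSinhSq a b) k z ∧
      Filter.Tendsto (fun p : ℝ × ℝ => closedForm p.1 b p.2)
        (nhdsWithin (a, k) {p : ℝ × ℝ | p.1 ≠ 1 ∧ p.2 ≠ 0}) (nhds z)) := by
  refine ⟨integrable_invSqAddSinhSq ha hb.ne', memLp_two_invSqAddSinhSq ha hb.ne',
    fun k ha1 hk => ?_, fun k => ⟨_, hasFourierTransformAt_invSqAddSinhSq ha hb.ne' k, ?_⟩⟩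
  · rw [← integral_fourier_invSqAddSinhSq ha hb ha1 hk]
    exact hasFourierTransformAt_invSqAddSinhSq ha hb.ne' k
  -- On the punctured set the closed form coincides with the Fourier integral, so it inherits the
  -- limit.
  · refine ((continuousAt_integral_fourier_invSqAddSinhSq ha hb.ne' k).tendsto.mono_left
      nhdsWithin_le_nhds).congr' ?_
    have hpos : ∀ᶠ p : ℝ × ℝ in 𝓝 (a, k), 0 < p.1 :=
      continuousAt_fst.eventually (lt_mem_nhds ha)
    filter_upwards [self_mem_nhdsWithin, nhdsWithin_le_nhds hpos] with p hp hp0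
    exact integral_fourier_invSqAddSinhSq hp0 hb hp.1 hp.2
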